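/- **Setting.** Let $T,n\ge 1$ and let $G=([T],\mathcal E)$ be the complete graph on $[T]=\{1,\dots,T\}$. Let $x=(x_1,\dots,x_T)\in\mathbb R^{nT}$ with $x_t\in\mathbb R^n$, let $C_t\in\mathbb R^{m_t\times n}$ for $t\in[T]$, let $C=\mathrm{diag}(C_1,\dots,C_T)$ be the block-diagonal matrix with blocks $C_t$, and let $O_T=[C_1^\top\ \cdots\ C_T^\top]^\top$. Let $M=D\otimes I_n$, where $D$ is the oriented incidence matrix of $G$, so that $\|Mx\|_2^2=\sum_{\{t,t'\}\in\mathcal E}\|x_t-x_{t'}\|_2^2$. We observe $y=Cx+\eta$, where $\eta$ is a random vector in $\mathbb R^{\sum_t m_t}$ which is $\sigma$-subgaussian for some $\sigma\ge 0$, i.e. $\mathbb E\,e^{s\,u^\top\eta}\le e^{s^2\sigma^2/2}$ for all $s\in\mathbb R$ and all $u$ with $\|u\|_2=1$. For $\mu>0$, $\hat x$ denotes the estimator $$\hat x\in\operatorname*{argmin}_{z\in\mathbb R^{nT}}\Big\{\tfrac12\|y-Cz\|_2^2+\tfrac{\mu}{2}\|Mz\|_2^2\Big\}.$$ $\|C\|_2$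 denotes the spectral norm, and $\lambda_{\min},\lambda_{\max}$ the smallest and largest eigenvalue of a symmetric matrix. **Corollary (complete graph).** There exist universal constants $c_1,c_2>0$ such that the following holds in the above setting. Suppose that $\underline\lambda_{\min},\overline\lambda_{\max}>0$ satisfy $\underline\lambda_{\min}\le\lambda_{\min}(O_T^\top O_T)$ and $\lambda_{\max}(O_T^\top O_T)\le\overline\lambda_{\max}$, and that $\|Mx\|_2^2\le S_T$ for some $S_T>0$. Let $\hat x$ be the estimator for the choice $$\mu=\mu^*=\max\left\{(2n\sigma^2\|C\|_2^2)^{1/3}\Big(\frac{\underline\lambda_{\min}}{S_T}\Big)^{1/3}\frac1{T^{2/3}}-\frac{\underline\lambda_{\min}}{T^2},\ \ \frac{c_1}{T}\Big(\frac{\underline\lambda_{\min}}{T}+\|C\|_2^2\,\frac{\overline\lambda_{\max}}{\underline\lambda_{\min}}\Big)\right\}.$$ Then for every $\delta\in(0,e^{-1})$, with probability at least $1-\delta$, $$\|\hat x-x\|_2^2\le c_2\left(\frac{S_T}{T}+\|C\|_2^2\,\frac{\overline\lambda_{\max}}{\underline\lambda_{\min}^2}\,S_T+\left(\frac{(n\sigma^2\|C\|_2^2)^{1/3}\,T^{1/3}S_T^{2/3}}{\underline\lambda_{\min}^{2/3}}+\frac{n\sigma^2\|C\|_2^2\,T^2}{\underline\lambda_{\min}^2}\right)\log\Big(\frac1\delta\Big)\right).$$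 -/

import Mathlib

open MeasureTheory ProbabilityTheory
open scoped NNReal Matrix Kronecker RealInnerProductSpace

noncomputable section

namespace GraphSignal

/-- The edges of a graph on `[T]`, each listed once and oriented from its smaller endpoint
to its larger one. -/
abbrev OrientedEdge {T : ℕ} (G : SimpleGraph (Fin T)) : Type :=
  {e : Fin T × Fin T // e.1 < e.2 ∧ G.Adj e.1 e.2}

/-- The oriented incidence matrix `D ∈ {0, -1, 1}^{|E| × T}`. -/
def incidence {T : ℕ} (G : SimpleGraph (Fin T)) : Matrix (OrientedEdge G) (Fin T) ℝ :=
  Matrix.of fun e t => if t = e.1.1 then 1 else if t = e.1.2 then -1 else 0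

/-- `M = D ⊗ I_n`. The coordinate `i` of the signal at the vertex `t` has the index `(t, i)`. -/
def penaltyMatrix {T : ℕ} (n : ℕ) (G : SimpleGraph (Fin T)) :
    Matrix (OrientedEdge G × Fin n) (Fin T × Fin n) ℝ :=
  incidence G ⊗ₖ (1 : Matrix (Fin n) (Fin n) ℝ)

/-- The block-diagonal matrix `C = diag(C_1, …, C_T)`. -/
def blockMatrix {T n : ℕ} {m : Fin T → ℕ} (C : (t : Fin T) → Matrix (Fin (m t)) (Fin n) ℝ) :
    Matrix ((t : Fin T) × Fin (m t)) (Fin T × Fin n) ℝ :=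
  Matrix.of fun p q => if p.1 = q.1 then C p.1 p.2 q.2 else 0

/-- The stacked matrix `O_T = [C_1ᵀ C_2ᵀ ⋯ C_Tᵀ]ᵀ`. -/
def stackMatrix {T n : ℕ} {m : Fin T → ℕ} (C : (t : Fin T) → Matrix (Fin (m t)) (Fin n) ℝ) :
    Matrix ((t : Fin T) × Fin (m t)) (Fin n) ℝ :=
  Matrix.of fun p j => C p.1 p.2 j

theorem gram_isHermitian {ι κ : Type*} [Fintype ι] (A : Matrix ι κ ℝ) :
    (Aᵀ * A).IsHermitian := by
  rw [Matrix.IsHermitian, Matrix.conjTranspose_eq_transpose_of_trivial, Matrix.transpose_mul,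
    Matrix.transpose_transpose]

/-- The smallest eigenvalue of a real symmetric matrix (of positive size). -/
def lambdaMin {ι : Type*} [Fintype ι] [DecidableEq ι] {A : Matrix ι ι ℝ}
    (hA : A.IsHermitian) : ℝ :=
  ⨅ i, hA.eigenvalues i

/-- The largest eigenvalue of a real symmetric matrix (of positive size). -/
def lambdaMax {ι : Type*} [Fintype ι] [DecidableEq ι] {A : Matrix ι ι ℝ}
    (hA : A.IsHermitian) : ℝ :=
  ⨆ i, hA.eigenvalues i

/-- The spectral norm `‖A‖₂`. -/
def specNorm {ι κ : Type*} [Fintype ι] [Fintype κ] [DecidableEq κ] (A : Matrix ι κ ℝ) : ℝ :=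
  ‖(Matrix.toEuclideanLin A).toContinuousLinearMap‖

/-- The objective `½ ‖y - C z‖₂² + (μ/2) ‖M z‖₂²` of the smoothness-penalized least squares
problem. -/
def penLSObjective {T n : ℕ} {m : Fin T → ℕ} (G : SimpleGraph (Fin T)) [DecidableRel G.Adj]
    (C : (t : Fin T) → Matrix (Fin (m t)) (Fin n) ℝ) (μ : ℝ)
    (y : EuclideanSpace ℝ ((t : Fin T) × Fin (m t))) (z : EuclideanSpace ℝ (Fin T × Fin n)) : ℝ :=
  1 / 2 * ‖y - Matrix.toEuclideanLin (blockMatrix C) z‖ ^ 2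
    + μ / 2 * ‖Matrix.toEuclideanLin (penaltyMatrix n G) z‖ ^ 2

/-- A random vector `η` is `σ`-subgaussian if `𝔼 exp(s ⟪u, η⟫) ≤ exp(s² σ² / 2)` for every real
`s` and every unit vector `u`. -/
def IsSubgaussianVec {Ω ι : Type*} [MeasurableSpace Ω] [Fintype ι]
    (η : Ω → EuclideanSpace ℝ ι) (σ : ℝ≥0) (P : Measure Ω) : Prop :=
  ∀ u : EuclideanSpace ℝ ι, ‖u‖ = 1 → HasSubgaussianMGF (fun ω => ⟪u, η ω⟫) (σ ^ 2) P

/-- The regularization parameter `μ*` for the complete graph. Here `K` stands for `‖C‖₂`, and `l`,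
`L` are the lower and upper bounds on the extreme eigenvalues of `O_Tᵀ O_T`. -/
def muStar (c₁ : ℝ) (T n : ℕ) (σ K l L S : ℝ) : ℝ :=
  max
    ((2 * n * σ ^ 2 * K ^ 2) ^ (1 / 3 : ℝ) * (l / S) ^ (1 / 3 : ℝ) * (1 / (T : ℝ) ^ (2 / 3 : ℝ))
      - l / (T : ℝ) ^ 2)
    (c₁ / T * (l / T + K ^ 2 * (L / l)))

end GraphSignal

end

open GraphSignal

/-! On the complete graph the penalty is exactly `‖M v‖² = T ‖v - Q v‖²`, where `Q = meanProj`
projects onto the constant signals: it controls everything orthogonal to the constants, while on the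
constants `C` acts as `O_T` and is bounded below by `l / T` in squared norm. Put `A = C†C + μ M†M`.
The lower bounds on `μ T` built into the second branch of `μ*` make `A ≥ l / (3T)`
(`coercive_regOp`), and the normal equations give `xhat - x = A⁻¹C†η - μ A⁻¹M†M x`.

The bias term is bounded uniformly in `μ` (`bias_le`). The noise term is a sum of squares of
subgaussian variables whose variance proxies add up to at most `σ² K² ‖A⁻¹‖_F²`. The `n` constant
directions contribute order `n T² / l²` to this Frobenius norm and the others order `n T / (μ T)²`
(`sum_norm_sq_inverse_le`). The first branch of `μ*` turns the latter into the cube-root rate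
(`div_muStar_sq_le`). Concentration needs no independence (`measureReal_sum_sq_le`). -/

namespace GraphSignal

/-! ### Concentration of sums of squares of subgaussian variables -/

theorem lintegral_exp_sq_gaussianReal :
    ∫⁻ g, ENNReal.ofReal (Real.exp (g ^ 2 / 4)) ∂(gaussianReal 0 1) = ENNReal.ofReal √2 := by
  have h1 : ∀ g : ℝ, gaussianPDF 0 1 g * ENNReal.ofReal (Real.exp (g ^ 2 / 4))
      = ENNReal.ofReal ((√(2 * Real.pi))⁻¹ * Real.exp (-(1 / 4) * g ^ 2)) := by
    intro g
    rw [gaussianPDF, ← ENNReal.ofReal_mul (gaussianPDFReal_nonneg _ _ _), gaussianPDFReal_def]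
    simp only [NNReal.coe_one, mul_one, sub_zero]
    rw [mul_assoc, ← Real.exp_add]
    congr 3
    ring
  rw [gaussianReal_of_var_ne_zero _ one_ne_zero,
    lintegral_withDensity_eq_lintegral_mul _ (measurable_gaussianPDF _ _) (by fun_prop)]
  simp only [Pi.mul_apply, h1]
  rw [← ofReal_integral_eq_lintegral_ofReal
    ((integrable_exp_neg_mul_sq (by norm_num : (0 : ℝ) < 1 / 4)).const_mul _)
    (Filter.Eventually.of_forall fun x => by positivity), integral_const_mul, integral_gaussian]
  congr 1
  rw [← Real.sqrt_inv, ← Real.sqrt_mul (by positivity)]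
  congr 1
  field_simp
  norm_num

theorem lintegral_exp_mul_gaussianReal (t : ℝ) :
    ∫⁻ g, ENNReal.ofReal (Real.exp (t * g)) ∂(gaussianReal 0 1)
      = ENNReal.ofReal (Real.exp (t ^ 2 / 2)) := by
  rw [← ofReal_integral_eq_lintegral_ofReal (integrable_exp_mul_gaussianReal t)
    (Filter.Eventually.of_forall fun x => by positivity)]
  have := mgf_gaussianReal (p := gaussianReal 0 1) (X := id) (μ := 0) (v := 1) (by simp) t
  simp only [mgf, id] at this
  rw [this]
  simp

variable {Ω : Type*} [MeasurableSpace Ω] {P : Measure Ω}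

/-- Linearize the square with an auxiliary standard Gaussian `g`: `exp (X² / (4c))` is the mean over
`g` of `exp (s X g)` with `s² = 1 / (2c)`. After exchanging the integrals, the subgaussian bound in
`X` leaves the mean of `exp (g² / 4)`. -/
theorem lintegral_exp_sq_le [SFinite P] {X : Ω → ℝ} {c : ℝ≥0} (hX : Measurable X)
    (h : HasSubgaussianMGF X c P) (hc : 0 < c) :
    ∫⁻ ω, ENNReal.ofReal (Real.exp (X ω ^ 2 / (4 * c))) ∂P ≤ ENNReal.ofReal √2 := by
  have hc' : (0 : ℝ) < c := hc
  set s : ℝ := √(1 / (2 * c))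
  have hs : s ^ 2 = 1 / (2 * c) := Real.sq_sqrt (by positivity)
  calc ∫⁻ ω, ENNReal.ofReal (Real.exp (X ω ^ 2 / (4 * c))) ∂P
      = ∫⁻ ω, ∫⁻ g, ENNReal.ofReal (Real.exp ((s * X ω) * g)) ∂(gaussianReal 0 1) ∂P := by
        refine lintegral_congr fun ω => ?_
        rw [lintegral_exp_mul_gaussianReal, mul_pow, hs]
        congr 2
        field_simp
        norm_num
    _ = ∫⁻ g, ∫⁻ ω, ENNReal.ofReal (Real.exp ((s * X ω) * g)) ∂P ∂(gaussianReal 0 1) :=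
        lintegral_lintegral_swap (by
          refine Measurable.aemeasurable ?_
          unfold Function.uncurry
          fun_prop)
    _ ≤ ∫⁻ g, ENNReal.ofReal (Real.exp (g ^ 2 / 4)) ∂(gaussianReal 0 1) := by
        refine lintegral_mono fun g => ?_
        have e : ∀ ω, (s * X ω) * g = (s * g) * X ω := fun ω => by ring
        simp only [e]
        rw [← ofReal_integral_eq_lintegral_ofReal (h.integrable_exp_mul (s * g))
          (Filter.Eventually.of_forall fun x => by positivity)]
        refine ENNReal.ofReal_le_ofReal ((h.mgf_le (s * g)).trans (Real.exp_le_exp.2 (le_of_eq ?_)))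
        rw [mul_pow, hs]
        field_simp
        ring
    _ = ENNReal.ofReal √2 := lintegral_exp_sq_gaussianReal

theorem ae_eq_zero_of_hasSubgaussianMGF_zero {X : Ω → ℝ} (h : HasSubgaussianMGF X 0 P) :
    ∀ᵐ ω ∂P, X ω = 0 := by
  have : X =ᵐ[P] 0 := by
    simpa using Kernel.HasSubgaussianMGF.ae_eq_zero_of_hasSubgaussianMGF_zero'
      (HasSubgaussianMGF_iff_kernel.1 h)
  exact this

/-- Jensen's inequality for `exp` with weights `c i / V` reduces the sum to single coordinates,
whatever their dependence. Coordinates with `c i = 0` have weight zero but vanish almost surely. -/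
theorem lintegral_exp_sum_sq_le [SFinite P] {ι : Type*} [Fintype ι] {X : ι → Ω → ℝ} {c : ι → ℝ≥0}
    (hX : ∀ i, Measurable (X i)) (h : ∀ i, HasSubgaussianMGF (X i) (c i) P)
    (hV : 0 < ∑ i, (c i : ℝ)) :
    ∫⁻ ω, ENNReal.ofReal (Real.exp ((∑ i, X i ω ^ 2) / (4 * ∑ i, (c i : ℝ)))) ∂P
      ≤ ENNReal.ofReal √2 := by
  set V := ∑ i, (c i : ℝ)
  have h0 : ∀ᵐ ω ∂P, ∀ i, c i = 0 → X i ω = 0 := by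
    rw [ae_all_iff]
    intro i
    by_cases hi : c i = 0
    · have := h i
      rw [hi] at this
      filter_upwards [ae_eq_zero_of_hasSubgaussianMGF_zero this] with ω hω _ using hω
    · exact Filter.Eventually.of_forall fun ω h' => absurd h' hi
  calc _ ≤ ∫⁻ ω, ∑ i, ENNReal.ofReal (c i / V)
        * ENNReal.ofReal (Real.exp (X i ω ^ 2 / (4 * c i))) ∂P := by
        refine lintegral_mono_ae ?_
        filter_upwards [h0] with ω hω
        have e : (∑ i, X i ω ^ 2) / (4 * V) = ∑ i, (c i / V) • (X i ω ^ 2 / (4 * c i)) := by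
          rw [Finset.sum_div]
          refine Finset.sum_congr rfl fun i _ => ?_
          by_cases hi : c i = 0
          · simp [hω i hi]
          · have : (c i : ℝ) ≠ 0 := by exact_mod_cast hi
            rw [smul_eq_mul]
            field_simp
        have j := convexOn_exp.map_sum_le (t := Finset.univ) (w := fun i => (c i : ℝ) / V)
          (p := fun i => X i ω ^ 2 / (4 * c i)) (fun i _ => by positivity)
          (by rw [← Finset.sum_div]; exact div_self hV.ne') (fun i _ => Set.mem_univ _)
        rw [e]
        refine (ENNReal.ofReal_le_ofReal j).trans (le_of_eq ?_)
        rw [ENNReal.ofReal_sum_of_nonneg (fun i _ => by positivity)]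
        refine Finset.sum_congr rfl fun i _ => ?_
        rw [smul_eq_mul, ENNReal.ofReal_mul (by positivity)]
    _ = ∑ i, ENNReal.ofReal (c i / V)
        * ∫⁻ ω, ENNReal.ofReal (Real.exp (X i ω ^ 2 / (4 * c i))) ∂P := by
        rw [lintegral_finsetSum _ (fun i _ => by have := hX i; fun_prop)]
        refine Finset.sum_congr rfl fun i _ => ?_
        rw [lintegral_const_mul _ (by have := hX i; fun_prop)]
    _ ≤ ∑ i, ENNReal.ofReal (c i / V) * ENNReal.ofReal √2 := by
        refine Finset.sum_le_sum fun i _ => ?_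
        by_cases hi : c i = 0
        · simp [hi]
        · gcongr
          exact lintegral_exp_sq_le (hX i) (h i) (pos_iff_ne_zero.2 hi)
    _ = ENNReal.ofReal √2 := by
        rw [← Finset.sum_mul, ← ENNReal.ofReal_sum_of_nonneg (fun i _ => by positivity),
          ← Finset.sum_div, div_self hV.ne']
        simp

theorem measureReal_sum_sq_le [IsProbabilityMeasure P] {ι : Type*} [Fintype ι] {X : ι → Ω → ℝ}
    {c : ι → ℝ≥0} (hX : ∀ i, Measurable (X i)) (h : ∀ i, HasSubgaussianMGF (X i) (c i) P)
    {δ : ℝ} (hδ : 0 < δ) (hδ' : δ < Real.exp (-1)) :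
    1 - δ ≤ P.real {ω | ∑ i, X i ω ^ 2 ≤ 6 * (∑ i, (c i : ℝ)) * Real.log (1 / δ)} := by
  have hm : Measurable fun ω => ∑ i, X i ω ^ 2 := by fun_prop
  have hlog : 1 ≤ Real.log (1 / δ) := by
    rw [one_div, Real.log_inv]
    have := Real.log_lt_log hδ hδ'
    rw [Real.log_exp] at this
    linarith
  rcases (Finset.sum_nonneg fun i _ => (c i).2 : 0 ≤ ∑ i, (c i : ℝ)).eq_or_lt with hV | hV
  · have hc : ∀ i, c i = 0 := fun i => by
      have := (Finset.sum_eq_zero_iff_of_nonneg fun i _ => (c i).2).1 hV.symm i (Finset.mem_univ i)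
      exact NNReal.coe_eq_zero.1 this
    have h0 : ∀ᵐ ω ∂P, ∀ i, X i ω = 0 := ae_all_iff.2 fun i =>
      ae_eq_zero_of_hasSubgaussianMGF_zero (hc i ▸ h i)
    have : P.real {ω | ∑ i, X i ω ^ 2 ≤ 6 * (∑ i, (c i : ℝ)) * Real.log (1 / δ)} = 1 := by
      rw [measureReal_def, (mem_ae_iff_prob_eq_one (measurableSet_le hm measurable_const)).1 ?_,
        ENNReal.toReal_one]
      filter_upwards [h0] with ω hω
      simp [hω, hc]
    rw [this]
    linarith
  · set V := ∑ i, (c i : ℝ)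
    set f : Ω → ENNReal := fun ω => ENNReal.ofReal (Real.exp ((∑ i, X i ω ^ 2) / (4 * V)))
    have hmarkov := mul_meas_ge_le_lintegral (μ := P) (f := f) (by fun_prop)
      (ENNReal.ofReal (√2 / δ))
    have hle := hmarkov.trans (lintegral_exp_sum_sq_le hX h hV)
    have hbad : P.real {ω | ENNReal.ofReal (√2 / δ) ≤ f ω} ≤ δ := by
      have := ENNReal.toReal_mono ENNReal.ofReal_ne_top hle
      rw [ENNReal.toReal_mul, ENNReal.toReal_ofReal (by positivity),
        ENNReal.toReal_ofReal (by positivity), div_mul_eq_mul_div, div_le_iff₀ hδ] at this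
      exact le_of_mul_le_mul_left this (by positivity)
    have hgood : MeasurableSet {ω | ∑ i, X i ω ^ 2 ≤ 6 * V * Real.log (1 / δ)} :=
      measurableSet_le hm measurable_const
    have hsub : {ω | ∑ i, X i ω ^ 2 ≤ 6 * V * Real.log (1 / δ)}ᶜ
        ⊆ {ω | ENNReal.ofReal (√2 / δ) ≤ f ω} := by
      intro ω hω
      simp only [Set.mem_compl_iff, Set.mem_ofPred_eq, not_le] at hω ⊢
      -- The constant 6 is 4 · (3/2): since `log (1/δ) ≥ 1`, one has `(3/2) log (1/δ) ≥ log (1/δ) +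
      -- (log 2)/2 = log (√2/δ)`.
      refine ENNReal.ofReal_le_ofReal ?_
      rw [← Real.log_le_iff_le_exp (by positivity), le_div_iff₀ (by positivity),
        div_eq_mul_one_div, Real.log_mul (by positivity) (by positivity),
        Real.log_sqrt (by norm_num)]
      have := Real.log_two_lt_d9
      nlinarith
    have := measureReal_mono hsub (μ := P)
    rw [probReal_compl_eq_one_sub hgood] at this
    linarith

end GraphSignal

/-! ### Quadratically regularized least squares with `‖M v‖² = T ‖v - Q v‖²` -/

namespace GraphSignal

section RegularizedLeastSquares

variable {E H F : Type*}
  [NormedAddCommGroup E] [InnerProductSpace ℝ E] [FiniteDimensional ℝ E]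
  [NormedAddCommGroup H] [InnerProductSpace ℝ H] [FiniteDimensional ℝ H]
  [NormedAddCommGroup F] [InnerProductSpace ℝ F] [FiniteDimensional ℝ F]

/-- The operator `C† C + μ M† M` of the normal equations. -/
noncomputable def regOp (C : E →ₗ[ℝ] H) (M : E →ₗ[ℝ] F) (μ : ℝ) : E →ₗ[ℝ] E :=
  LinearMap.adjoint C ∘ₗ C + μ • (LinearMap.adjoint M ∘ₗ M)

theorem inner_regOp (C : E →ₗ[ℝ] H) (M : E →ₗ[ℝ] F) (μ : ℝ) (v w : E) :
    ⟪regOp C M μ v, w⟫ = ⟪C v, C w⟫ + μ * ⟪M v, M w⟫ := by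
  simp [regOp, inner_add_left, inner_smul_left, LinearMap.adjoint_inner_left]

theorem inner_regOp_self (C : E →ₗ[ℝ] H) (M : E →ₗ[ℝ] F) (μ : ℝ) (v : E) :
    ⟪regOp C M μ v, v⟫ = ‖C v‖ ^ 2 + μ * ‖M v‖ ^ 2 := by
  simp [inner_regOp]

theorem regOp_isSymmetric (C : E →ₗ[ℝ] H) (M : E →ₗ[ℝ] F) (μ : ℝ) :
    (regOp C M μ).IsSymmetric := fun v w => by
  rw [real_inner_comm _ v, inner_regOp, inner_regOp, real_inner_comm (C v), real_inner_comm (M v)]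

theorem regOp_eq_of_isMinOn {C : E →ₗ[ℝ] H} {M : E →ₗ[ℝ] F} {μ : ℝ} {y : H} {z : E}
    (hz : IsMinOn (fun z => 1 / 2 * ‖y - C z‖ ^ 2 + μ / 2 * ‖M z‖ ^ 2) Set.univ z) :
    regOp C M μ z = LinearMap.adjoint C y := by
  refine ext_inner_right ℝ fun w => ?_
  rw [inner_regOp, LinearMap.adjoint_inner_left, ← sub_eq_zero]
  -- Perturbing the minimizer by `t • w` gives a nonnegative quadratic in `t` without constant term,
  -- so its discriminant forces the linear coefficient to vanish.
  have key : ∀ t : ℝ, 0 ≤ (1 / 2 * ‖C w‖ ^ 2 + μ / 2 * ‖M w‖ ^ 2) * (t * t)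
      + (⟪C z, C w⟫ + μ * ⟪M z, M w⟫ - ⟪y, C w⟫) * t + 0 := by
    intro t
    have h : 1 / 2 * ‖y - C z‖ ^ 2 + μ / 2 * ‖M z‖ ^ 2
        ≤ 1 / 2 * ‖y - C (z + t • w)‖ ^ 2 + μ / 2 * ‖M (z + t • w)‖ ^ 2 := hz (Set.mem_univ _)
    have e : y - C (z + t • w) = (y - C z) - t • C w := by rw [map_add, map_smul]; abel
    rw [e, map_add, map_smul, norm_sub_sq_real (y - C z), norm_add_sq_real, inner_smul_right,
      inner_smul_right, norm_smul, norm_smul, inner_sub_left, mul_pow, mul_pow, Real.norm_eq_abs,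
      sq_abs] at h
    nlinarith
  have := discrim_le_zero key
  rw [discrim] at this
  nlinarith

variable {C : E →ₗ[ℝ] H} {M : E →ₗ[ℝ] F} {Q : E →ₗ[ℝ] E} {K l T μ S : ℝ}

omit [FiniteDimensional ℝ E] in
theorem norm_sq_eq_add_of_projection (hQs : Q.IsSymmetric) (hQi : ∀ v, Q (Q v) = Q v) (v : E) :
    ‖v‖ ^ 2 = ‖Q v‖ ^ 2 + ‖v - Q v‖ ^ 2 := by
  have h : ⟪Q v, v - Q v⟫ = 0 := by
    rw [hQs, map_sub, hQi, sub_self, inner_zero_right]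
  conv_lhs => rw [← add_sub_cancel (Q v) v, norm_add_sq_real, h]
  ring

/-- With `w = v - Q v`, `‖C (Q v)‖² ≤ 2‖C v‖² + 2‖C w‖²`, and `‖C w‖²` is absorbed by the penalty `μ
T ‖w‖²`. Two copies of the penalty pay for `C w` and one for `‖w‖²` itself, whence the 3. -/
theorem coercive_regOp (hQs : Q.IsSymmetric) (hQi : ∀ v, Q (Q v) = Q v)
    (hM : ∀ v, ‖M v‖ ^ 2 = T * ‖v - Q v‖ ^ 2) (hC : ∀ v, l / T * ‖Q v‖ ^ 2 ≤ ‖C (Q v)‖ ^ 2)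
    (hK : ∀ v, ‖C v‖ ≤ K * ‖v‖) (hl : 0 < l) (hT : 0 < T) (h₁ : l / T ≤ μ * T)
    (h₂ : K ^ 2 ≤ μ * T) (v : E) :
    l / (3 * T) * ‖v‖ ^ 2 ≤ ⟪regOp C M μ v, v⟫ := by
  rw [inner_regOp_self, hM, norm_sq_eq_add_of_projection hQs hQi v]
  set w := v - Q v
  have e : C (Q v) = C v - C w := by rw [← map_sub, sub_sub_cancel]
  have h3 : ‖C (Q v)‖ ^ 2 ≤ 2 * ‖C v‖ ^ 2 + 2 * ‖C w‖ ^ 2 := by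
    have := parallelogram_law_with_norm ℝ (C v) (C w)
    rw [e]
    nlinarith [sq_nonneg ‖C v + C w‖]
  have h4 : ‖C w‖ ^ 2 ≤ μ * T * ‖w‖ ^ 2 := by
    calc ‖C w‖ ^ 2 ≤ (K * ‖w‖) ^ 2 := by gcongr; exact hK w
      _ = K ^ 2 * ‖w‖ ^ 2 := by ring
      _ ≤ _ := by gcongr
  have h5 : l / T * ‖w‖ ^ 2 ≤ μ * T * ‖w‖ ^ 2 := by gcongr
  have h6 := hC v
  have e2 : l / (3 * T) = l / T / 3 := by field_simp
  rw [e2]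
  nlinarith [sq_nonneg ‖C v‖]

/-- The equation is tested twice. Against `b` it gives `‖M b‖ ≤ ‖M x‖`, which bounds `b - Q b`.
Against `Q b`, which `M` kills, it says `C b ⊥ C (Q b)`, so `C (Q b)` is controlled by `C (b - Q
b)`. Neither bound depends on `μ`. -/
theorem bias_le (hQs : Q.IsSymmetric) (hQi : ∀ v, Q (Q v) = Q v)
    (hM : ∀ v, ‖M v‖ ^ 2 = T * ‖v - Q v‖ ^ 2) (hC : ∀ v, l / T * ‖Q v‖ ^ 2 ≤ ‖C (Q v)‖ ^ 2)
    (hK : ∀ v, ‖C v‖ ≤ K * ‖v‖) (hl : 0 < l) (hT : 0 < T) (hμ : 0 < μ) {x b : E}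
    (hx : ‖M x‖ ^ 2 ≤ S) (hb : regOp C M μ b = -(μ • LinearMap.adjoint M (M x))) :
    ‖b‖ ^ 2 ≤ S / T + K ^ 2 * S / l := by
  have test : ∀ w, ⟪C b, C w⟫ + μ * ⟪M b, M w⟫ = -(μ * ⟪M x, M w⟫) := by
    intro w
    rw [← inner_regOp, hb, inner_neg_left, inner_smul_left, LinearMap.adjoint_inner_left]
    rfl
  have h1 : ‖M b‖ ≤ ‖M x‖ := by
    have := test b
    rw [real_inner_self_eq_norm_sq, real_inner_self_eq_norm_sq] at this
    have h2 : -⟪M x, M b⟫ ≤ ‖M x‖ * ‖M b‖ :=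
      (neg_le_abs _).trans (abs_real_inner_le_norm _ _)
    have h3 : μ * (‖M b‖ * ‖M b‖) ≤ μ * (‖M x‖ * ‖M b‖) := by
      nlinarith [sq_nonneg ‖C b‖]
    have h4 := le_of_mul_le_mul_left h3 hμ
    by_contra! h5
    have : 0 < ‖M b‖ := (norm_nonneg _).trans_lt h5
    nlinarith
  have hw : ‖b - Q b‖ ^ 2 ≤ S / T := by
    rw [le_div_iff₀ hT, mul_comm, ← hM]
    exact (pow_le_pow_left₀ (norm_nonneg _) h1 2).trans hx
  have hMQ : M (Q b) = 0 := by
    have := hM (Q b)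
    rw [hQi, sub_self, norm_zero] at this
    simpa using this
  have h6 : ‖C (Q b)‖ ≤ K * ‖b - Q b‖ := by
    have := test (Q b)
    rw [hMQ, inner_zero_right, inner_zero_right] at this
    have e : C b = C (Q b) + C (b - Q b) := by rw [← map_add, add_sub_cancel]
    rw [e, inner_add_left, real_inner_self_eq_norm_sq] at this
    have h7 : -⟪C (b - Q b), C (Q b)⟫ ≤ ‖C (b - Q b)‖ * ‖C (Q b)‖ :=
      (neg_le_abs _).trans (abs_real_inner_le_norm _ _)
    refine le_trans ?_ (hK (b - Q b))
    by_contra! h5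
    have : 0 < ‖C (Q b)‖ := (norm_nonneg _).trans_lt h5
    nlinarith
  have h8 : ‖Q b‖ ^ 2 ≤ K ^ 2 * S / l := by
    have h9 : ‖C (Q b)‖ ^ 2 ≤ K ^ 2 * (S / T) := by
      calc ‖C (Q b)‖ ^ 2 ≤ (K * ‖b - Q b‖) ^ 2 := by gcongr
        _ = K ^ 2 * ‖b - Q b‖ ^ 2 := by ring
        _ ≤ _ := by gcongr
    have h10 := (hC b).trans h9
    rw [div_mul_eq_mul_div, mul_div_assoc', div_le_div_iff_of_pos_right hT] at h10
    rw [le_div_iff₀ hl]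
    linarith
  rw [norm_sq_eq_add_of_projection hQs hQi b]
  linarith

omit [FiniteDimensional ℝ E] in
theorem sum_norm_sq_map_of_isSymmetric {ι : Type*} [Fintype ι] (b : OrthonormalBasis ι ℝ E)
    {A B : E →ₗ[ℝ] E} (hA : A.IsSymmetric) (hB : B.IsSymmetric) :
    ∑ k, ‖A (B (b k))‖ ^ 2 = ∑ k, ‖B (A (b k))‖ ^ 2 := by
  have e : ∀ v, ‖v‖ ^ 2 = ∑ j, ⟪b j, v⟫ ^ 2 := fun v => by
    rw [← b.sum_sq_norm_inner_right v]
    simp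
  simp only [e]
  rw [Finset.sum_comm]
  refine Finset.sum_congr rfl fun j _ => Finset.sum_congr rfl fun k _ => ?_
  rw [← hA, ← hB, real_inner_comm]

/-- With `P = 1 - Q`, split `R` into `Q R`, `P R P` and `P R Q`. The pieces with a factor `Q` see
only the rank of `Q` and cost `1/α²` per dimension, whereas `P R P` has operator norm at most `1 /
(μ T)`. -/
theorem sum_norm_sq_inverse_le (hQs : Q.IsSymmetric) (hQi : ∀ v, Q (Q v) = Q v)
    (hM : ∀ v, ‖M v‖ ^ 2 = T * ‖v - Q v‖ ^ 2) {α : ℝ} (hα : 0 < α)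
    (hcoer : ∀ v, α * ‖v‖ ^ 2 ≤ ⟪regOp C M μ v, v⟫) (hT : 0 < T) (hμ : 0 < μ)
    {R : E →ₗ[ℝ] E} (hR : ∀ v, regOp C M μ (R v) = v)
    {ι : Type*} [Fintype ι] (b : OrthonormalBasis ι ℝ E) :
    ∑ k, ‖R (b k)‖ ^ 2
      ≤ 3 * (∑ k, ‖Q (b k)‖ ^ 2) / α ^ 2 + 2 * Fintype.card ι / (μ * T) ^ 2 := by
  have hRs : R.IsSymmetric := fun u v => by
    have := regOp_isSymmetric C M μ (R u) (R v)
    rw [hR, hR] at this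
    exact this.symm
  have hRn : ∀ v, ‖R v‖ ^ 2 ≤ ‖v‖ ^ 2 / α ^ 2 := fun v => by
    have h1 := hcoer (R v)
    rw [hR] at h1
    have h2 : α * ‖R v‖ ≤ ‖v‖ := by
      have h3 := h1.trans (real_inner_le_norm _ _)
      by_contra! h5
      have : 0 < ‖R v‖ := by
        by_contra! h6
        have := norm_nonneg v
        nlinarith
      nlinarith
    rw [le_div_iff₀ (by positivity), ← mul_pow, mul_comm]
    exact pow_le_pow_left₀ (by positivity) h2 2
  have hnp : ∀ v, ‖v - Q v‖ ≤ ‖v‖ := fun v => by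
    refine le_of_sq_le_sq ?_ (norm_nonneg _)
    rw [norm_sq_eq_add_of_projection hQs hQi v]
    nlinarith [sq_nonneg ‖Q v‖]
  have hperp : ∀ v, ‖R (v - Q v) - Q (R (v - Q v))‖ ^ 2 ≤ ‖v‖ ^ 2 / (μ * T) ^ 2 := fun v => by
    set u := R (v - Q v)
    -- Pairing `A u = v - Q v` with `u` moves the projection onto `u`, so only `u - Q u` appears on
    -- the right and one factor of its norm cancels.
    have h1 : ‖C u‖ ^ 2 + μ * ‖M u‖ ^ 2 = ⟪v, u - Q u⟫ := by
      rw [← inner_regOp_self, hR, inner_sub_left, hQs, inner_sub_right]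
    have h2 := h1.le.trans (real_inner_le_norm _ _)
    rw [hM] at h2
    have h3 : μ * T * ‖u - Q u‖ ≤ ‖v‖ := by
      by_contra! h5
      have : 0 < ‖u - Q u‖ := by
        by_contra! h6
        have := norm_nonneg v
        have : 0 < μ * T := by positivity
        nlinarith
      nlinarith [sq_nonneg ‖C u‖]
    rw [le_div_iff₀ (by positivity), ← mul_pow, mul_comm]
    exact pow_le_pow_left₀ (by positivity) h3 2
  have hRQ : ∀ k, ‖R (Q (b k))‖ ^ 2 ≤ ‖Q (b k)‖ ^ 2 / α ^ 2 := fun k => hRn _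
  have hpt : ∀ k, ‖R (b k)‖ ^ 2
      ≤ ‖Q (R (b k))‖ ^ 2 + (2 * (1 / (μ * T) ^ 2) + 2 * (‖Q (b k)‖ ^ 2 / α ^ 2)) := fun k => by
    rw [norm_sq_eq_add_of_projection hQs hQi (R (b k))]
    set u := R (b k - Q (b k))
    set w := R (Q (b k))
    have e : R (b k) - Q (R (b k)) = (u - Q u) + (w - Q w) := by
      have : R (b k) = u + w := by rw [← map_add, sub_add_cancel]
      rw [this, map_add]
      abel
    have h1 := parallelogram_law_with_norm ℝ (u - Q u) (w - Q w)
    have h2 := hperp (b k)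
    rw [b.norm_eq_one, one_pow] at h2
    have h3 : ‖w - Q w‖ ^ 2 ≤ ‖w‖ ^ 2 := pow_le_pow_left₀ (norm_nonneg _) (hnp w) 2
    have h4 := hRQ k
    rw [e]
    nlinarith [sq_nonneg ‖(u - Q u) - (w - Q w)‖]
  calc ∑ k, ‖R (b k)‖ ^ 2
      ≤ ∑ k, (‖Q (R (b k))‖ ^ 2 + (2 * (1 / (μ * T) ^ 2) + 2 * (‖Q (b k)‖ ^ 2 / α ^ 2))) :=
        Finset.sum_le_sum fun k _ => hpt k
    _ = ∑ k, ‖R (Q (b k))‖ ^ 2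
          + (2 * Fintype.card ι / (μ * T) ^ 2 + 2 * (∑ k, ‖Q (b k)‖ ^ 2) / α ^ 2) := by
        -- `Q R` and `R Q` are adjoint, hence have equal Frobenius norms.
        rw [Finset.sum_add_distrib, Finset.sum_add_distrib,
          sum_norm_sq_map_of_isSymmetric b hQs hRs, ← Finset.mul_sum, ← Finset.mul_sum,
          ← Finset.sum_div _ (fun k => ‖Q (b k)‖ ^ 2)]
        simp only [Finset.sum_const, Finset.card_univ, nsmul_eq_mul]
        ring
    _ ≤ (∑ k, ‖Q (b k)‖ ^ 2) / α ^ 2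
          + (2 * Fintype.card ι / (μ * T) ^ 2 + 2 * (∑ k, ‖Q (b k)‖ ^ 2) / α ^ 2) := by
        gcongr
        rw [Finset.sum_div]
        exact Finset.sum_le_sum fun k _ => hRQ k
    _ = _ := by ring

theorem exists_rightInverse_regOp {α : ℝ} (hα : 0 < α)
    (hcoer : ∀ v, α * ‖v‖ ^ 2 ≤ ⟪regOp C M μ v, v⟫) :
    ∃ R : E →ₗ[ℝ] E, (∀ v, regOp C M μ (R v) = v) ∧ ∀ v, R (regOp C M μ v) = v := by
  have hinj : Function.Injective (regOp C M μ) := by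
    rw [injective_iff_map_eq_zero]
    intro v hv
    have := hcoer v
    rw [hv, inner_zero_left] at this
    have h2 : ‖v‖ ^ 2 ≤ 0 := by
      by_contra! h
      nlinarith
    simpa using le_antisymm h2 (sq_nonneg _)
  exact ⟨(LinearEquiv.ofInjectiveEndo _ hinj).symm.toLinearMap,
    fun v => (LinearEquiv.ofInjectiveEndo _ hinj).apply_symm_apply v,
    fun v => (LinearEquiv.ofInjectiveEndo _ hinj).symm_apply_apply v⟩

end RegularizedLeastSquares

end GraphSignal

/-! ### The complete graph, the observation matrix and the choice of `μ*` -/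

namespace GraphSignal

/-- The mean over the vertices of the signal `v`. -/
noncomputable def meanSignal (T n : ℕ) :
    EuclideanSpace ℝ (Fin T × Fin n) →ₗ[ℝ] EuclideanSpace ℝ (Fin n) where
  toFun v := WithLp.toLp 2 fun i => (∑ t, v (t, i)) / T
  map_add' v w := by
    ext i
    simp [Finset.sum_add_distrib, add_div]
  map_smul' c v := by
    ext i
    simp [← Finset.mul_sum, mul_div_assoc]

/-- The constant signal with value `a` at every vertex. -/
noncomputable def constSignal (T n : ℕ) :
    EuclideanSpace ℝ (Fin n) →ₗ[ℝ] EuclideanSpace ℝ (Fin T × Fin n) where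
  toFun a := WithLp.toLp 2 fun p => a p.2
  map_add' _ _ := rfl
  map_smul' _ _ := rfl

/-- The orthogonal projection onto the constant signals. -/
noncomputable def meanProj (T n : ℕ) :
    EuclideanSpace ℝ (Fin T × Fin n) →ₗ[ℝ] EuclideanSpace ℝ (Fin T × Fin n) :=
  constSignal T n ∘ₗ meanSignal T n

variable {T n : ℕ}

theorem meanProj_apply (v : EuclideanSpace ℝ (Fin T × Fin n)) (t : Fin T) (i : Fin n) :
    meanProj T n v (t, i) = (∑ s, v (s, i)) / T := rfl

theorem constSignal_apply (a : EuclideanSpace ℝ (Fin n)) (p : Fin T × Fin n) :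
    constSignal T n a p = a p.2 := rfl

theorem norm_constSignal_sq (a : EuclideanSpace ℝ (Fin n)) :
    ‖constSignal T n a‖ ^ 2 = T * ‖a‖ ^ 2 := by
  rw [EuclideanSpace.real_norm_sq_eq, EuclideanSpace.real_norm_sq_eq, Fintype.sum_prod_type]
  simp [constSignal_apply]

theorem meanProj_isSymmetric : (meanProj T n).IsSymmetric := fun v w => by
  simp only [PiLp.inner_apply, Fintype.sum_prod_type_right, meanProj_apply]
  refine Finset.sum_congr rfl fun i _ => ?_
  simp only [RCLike.inner_apply, conj_trivial]
  rw [← Finset.sum_mul, ← Finset.mul_sum]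
  ring

theorem meanProj_meanProj (hT : 0 < T) (v : EuclideanSpace ℝ (Fin T × Fin n)) :
    meanProj T n (meanProj T n v) = meanProj T n v := by
  have : (T : ℝ) ≠ 0 := by positivity
  ext ⟨t, i⟩
  rw [meanProj_apply]
  simp only [meanProj_apply, Finset.sum_const, Finset.card_univ, Fintype.card_fin, nsmul_eq_mul]
  field_simp

theorem sum_norm_sq_meanProj_basisFun (hT : 0 < T) :
    ∑ k, ‖meanProj T n (EuclideanSpace.basisFun (Fin T × Fin n) ℝ k)‖ ^ 2 = n := by
  have : (T : ℝ) ≠ 0 := by positivity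
  have h : ∀ t i s j, meanProj T n (EuclideanSpace.basisFun (Fin T × Fin n) ℝ (t, i)) (s, j)
      = if j = i then (1 : ℝ) / T else 0 := by
    intro t i s j
    rw [meanProj_apply]
    by_cases hij : j = i <;> simp [hij]
  simp only [EuclideanSpace.real_norm_sq_eq, Fintype.sum_prod_type, h]
  simp
  field_simp

/-- Both sides equal `T ∑ a² - (∑ a)²`; summing over ordered pairs counts each edge twice. -/
theorem sum_orientedEdge_top_sq [DecidableRel (⊤ : SimpleGraph (Fin T)).Adj] (hT : 0 < T)
    (a : Fin T → ℝ) :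
    ∑ e : OrientedEdge (⊤ : SimpleGraph (Fin T)), (a e.1.1 - a e.1.2) ^ 2
      = T * ∑ t, (a t - (∑ s, a s) / T) ^ 2 := by
  have hT' : (T : ℝ) ≠ 0 := by positivity
  have h1 : ∑ e : OrientedEdge (⊤ : SimpleGraph (Fin T)), (a e.1.1 - a e.1.2) ^ 2
      = ∑ s, ∑ t, if s < t then (a s - a t) ^ 2 else 0 := by
    rw [← Fintype.sum_prod_type' (f := fun s t => if s < t then (a s - a t) ^ 2 else 0),
      ← Finset.sum_filter]
    refine (Finset.sum_subtype _ (fun p => ?_) (fun p : Fin T × Fin T => (a p.1 - a p.2) ^ 2)).symm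
    simp only [Finset.mem_filter, Finset.mem_univ, true_and, SimpleGraph.top_adj]
    exact ⟨fun h => ⟨h, h.ne⟩, fun h => h.1⟩
  have h2 : ∑ s, ∑ t, (if s < t then (a s - a t) ^ 2 else 0)
      = ∑ s, ∑ t, if t < s then (a s - a t) ^ 2 else 0 := by
    rw [Finset.sum_comm]
    refine Finset.sum_congr rfl fun s _ => Finset.sum_congr rfl fun t _ => ?_
    rw [← neg_sub, neg_sq]
  have h3 : ∑ s, ∑ t, (a s - a t) ^ 2
      = 2 * ∑ s, ∑ t, if s < t then (a s - a t) ^ 2 else 0 := by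
    rw [two_mul]
    nth_rw 2 [h2]
    simp only [← Finset.sum_add_distrib]
    refine Finset.sum_congr rfl fun s _ => Finset.sum_congr rfl fun t _ => ?_
    rcases lt_trichotomy s t with h | h | h
    · simp [h, h.not_gt]
    · simp [h]
    · simp [h, h.not_gt]
  have h4 : ∑ s, ∑ t, (a s - a t) ^ 2 = 2 * (T * ∑ t, a t ^ 2 - (∑ t, a t) ^ 2) := by
    simp only [sub_sq, Finset.sum_add_distrib, Finset.sum_sub_distrib, ← Finset.mul_sum,
      ← Finset.sum_mul, Finset.sum_const, Finset.card_univ, Fintype.card_fin, nsmul_eq_mul]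
    ring
  have h5 : T * ∑ t, (a t - (∑ s, a s) / T) ^ 2 = T * ∑ t, a t ^ 2 - (∑ t, a t) ^ 2 := by
    simp only [sub_sq, Finset.sum_add_distrib, Finset.sum_sub_distrib, ← Finset.mul_sum,
      ← Finset.sum_mul, Finset.sum_const, Finset.card_univ, Fintype.card_fin, nsmul_eq_mul]
    field_simp
    ring
  rw [h1, h5]
  linarith

theorem toEuclideanLin_penaltyMatrix_apply (G : SimpleGraph (Fin T))
    (v : EuclideanSpace ℝ (Fin T × Fin n)) (e : OrientedEdge G) (i : Fin n) :
    Matrix.toEuclideanLin (penaltyMatrix n G) v (e, i) = v (e.1.1, i) - v (e.1.2, i) := by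
  have hne : e.1.1 ≠ e.1.2 := e.2.1.ne
  have h : ∀ t, (if t = e.1.1 then (1 : ℝ) else if t = e.1.2 then -1 else 0)
      = (if t = e.1.1 then 1 else 0) - (if t = e.1.2 then 1 else 0) := by
    intro t
    by_cases h1 : t = e.1.1
    · simp [h1, hne]
    · by_cases h2 : t = e.1.2 <;> simp [h1, h2, hne.symm]
  simp [Matrix.toLpLin_apply, Matrix.mulVec, dotProduct, penaltyMatrix, incidence,
    Fintype.sum_prod_type, Matrix.one_apply, h, sub_mul, Finset.sum_sub_distrib]

theorem norm_sq_penaltyMatrix_top [DecidableRel (⊤ : SimpleGraph (Fin T)).Adj] (hT : 0 < T)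
    (v : EuclideanSpace ℝ (Fin T × Fin n)) :
    ‖Matrix.toEuclideanLin (penaltyMatrix n (⊤ : SimpleGraph (Fin T))) v‖ ^ 2
      = T * ‖v - meanProj T n v‖ ^ 2 := by
  rw [EuclideanSpace.real_norm_sq_eq, EuclideanSpace.real_norm_sq_eq, Fintype.sum_prod_type_right,
    Fintype.sum_prod_type_right, Finset.mul_sum]
  refine Finset.sum_congr rfl fun i _ => ?_
  simp only [toEuclideanLin_penaltyMatrix_apply]
  exact sum_orientedEdge_top_sq hT fun t => v (t, i)

/-- This is how the spectrum of `O_Tᵀ O_T` enters: together with `norm_constSignal_sq` it bounds `C`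
below on the constants. -/
theorem toEuclideanLin_blockMatrix_constSignal {m : Fin T → ℕ}
    (C : (t : Fin T) → Matrix (Fin (m t)) (Fin n) ℝ) (a : EuclideanSpace ℝ (Fin n)) :
    Matrix.toEuclideanLin (blockMatrix C) (constSignal T n a)
      = Matrix.toEuclideanLin (stackMatrix C) a := by
  ext ⟨t, k⟩
  simp [Matrix.toLpLin_apply, Matrix.mulVec, dotProduct, blockMatrix, stackMatrix, constSignal_apply,
    Fintype.sum_prod_type_right]

theorem norm_toEuclideanLin_le_specNorm {ι κ : Type*} [Fintype ι] [Fintype κ] [DecidableEq κ]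
    (A : Matrix ι κ ℝ) (v : EuclideanSpace ℝ κ) :
    ‖Matrix.toEuclideanLin A v‖ ≤ specNorm A * ‖v‖ :=
  (Matrix.toEuclideanLin A).toContinuousLinearMap.le_opNorm v

theorem lambdaMin_mul_norm_sq_le {ι κ : Type*} [Fintype ι] [Fintype κ] [DecidableEq κ]
    (A : Matrix ι κ ℝ) (a : EuclideanSpace ℝ κ) :
    lambdaMin (gram_isHermitian A) * ‖a‖ ^ 2 ≤ ‖Matrix.toEuclideanLin A a‖ ^ 2 := by
  set h := gram_isHermitian A
  set b := h.eigenvectorBasis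
  have hb : ∀ i, Matrix.toEuclideanLin (Aᵀ * A) (b i) = h.eigenvalues i • b i := fun i => by
    ext j
    have := congrFun (h.mulVec_eigenvectorBasis i) j
    simpa [Matrix.toLpLin_apply] using this
  have hin : ∀ u v : EuclideanSpace ℝ κ, ⟪Matrix.toEuclideanLin A u, Matrix.toEuclideanLin A v⟫
      = ⟪Matrix.toEuclideanLin (Aᵀ * A) u, v⟫ := fun u v => by
    classical
    rw [Matrix.toLpLin_mul_same, LinearMap.comp_apply,
      ← Matrix.conjTranspose_eq_transpose_of_trivial,
      Matrix.toEuclideanLin_conjTranspose_eq_adjoint, LinearMap.adjoint_inner_left]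
  have hsum : ‖Matrix.toEuclideanLin A a‖ ^ 2 = ∑ i, h.eigenvalues i * ⟪b i, a⟫ ^ 2 := by
    rw [← real_inner_self_eq_norm_sq, hin,
      ← b.sum_inner_mul_inner (Matrix.toEuclideanLin (Aᵀ * A) a) a]
    refine Finset.sum_congr rfl fun i _ => ?_
    rw [← hin, real_inner_comm, hin, hb, inner_smul_left]
    simp only [conj_trivial]
    ring
  rw [hsum, ← b.sum_sq_norm_inner_right a, Finset.mul_sum]
  refine Finset.sum_le_sum fun i _ => ?_
  rw [Real.norm_eq_abs, sq_abs]
  gcongr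
  exact ciInf_le (Set.finite_range _).bddBelow i

theorem lambdaMin_le_lambdaMax {ι : Type*} [Fintype ι] [DecidableEq ι] [Nonempty ι]
    {A : Matrix ι ι ℝ} (hA : A.IsHermitian) : lambdaMin hA ≤ lambdaMax hA :=
  (ciInf_le (Set.finite_range _).bddBelow (Classical.arbitrary ι)).trans
    (le_ciSup (Set.finite_range _).bddAbove _)

theorem IsSubgaussianVec.hasSubgaussianMGF_inner {Ω ι : Type*} [MeasurableSpace Ω] [Fintype ι]
    {η : Ω → EuclideanSpace ℝ ι} {σ : ℝ≥0} {P : Measure Ω} [IsProbabilityMeasure P]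
    (h : IsSubgaussianVec η σ P) (u : EuclideanSpace ℝ ι) :
    HasSubgaussianMGF (fun ω => ⟪u, η ω⟫) (‖u‖₊ ^ 2 * σ ^ 2) P := by
  by_cases hu : u = 0
  · simp [hu, HasSubgaussianMGF.fun_zero]
  · have hn : ‖u‖ ≠ 0 := norm_ne_zero_iff.2 hu
    have h1 := (h (‖u‖⁻¹ • u) (norm_smul_inv_norm hu)).const_mul ‖u‖
    have e : (fun ω => ‖u‖ * ⟪‖u‖⁻¹ • u, η ω⟫) = fun ω => ⟪u, η ω⟫ := by
      ext ω
      rw [inner_smul_left]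
      simp only [conj_trivial]
      field_simp
    rw [e] at h1
    exact h1

/-- The second branch of the maximum, with `c₁ = 1` and `L / l ≥ 1`, supplies what coercivity
requires. -/
theorem muStar_one_pos_and_le {σ K l L S : ℝ} (hT : 1 ≤ T) (hl : 0 < l) (hlL : l ≤ L) :
    0 < muStar 1 T n σ K l L S ∧ l / T ≤ muStar 1 T n σ K l L S * T
      ∧ K ^ 2 ≤ muStar 1 T n σ K l L S * T := by
  have hT' : (0 : ℝ) < T := by exact_mod_cast hT
  have h : 1 / (T : ℝ) * (l / T + K ^ 2 * (L / l)) ≤ muStar 1 T n σ K l L S := le_max_right _ _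
  have h1 : l / T + K ^ 2 * (L / l) ≤ muStar 1 T n σ K l L S * T := by
    rw [one_div, inv_mul_le_iff₀ hT'] at h
    linarith
  have h2 : 1 ≤ L / l := (one_le_div hl).2 hlL
  have h3 : K ^ 2 ≤ K ^ 2 * (L / l) := le_mul_of_one_le_right (sq_nonneg K) h2
  have h4 : 0 < l / T := by positivity
  have h5 := sq_nonneg K
  refine ⟨?_, by linarith, by linarith⟩
  have : 0 < muStar 1 T n σ K l L S * T := by linarith
  exact pos_of_mul_pos_left this hT'.le

theorem div_muStar_sq_le {σ K l L S : ℝ} (hT : 1 ≤ T) (hl : 0 < l) (hlL : l ≤ L) (hS : 0 < S) :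
    n * σ ^ 2 * K ^ 2 / (T * muStar 1 T n σ K l L S ^ 2)
      ≤ 4 * ((n * σ ^ 2 * K ^ 2) ^ (1 / 3 : ℝ) * (T : ℝ) ^ (1 / 3 : ℝ) * S ^ (2 / 3 : ℝ)
        / l ^ (2 / 3 : ℝ)) := by
  have hT' : (0 : ℝ) < T := by exact_mod_cast hT
  obtain ⟨hμ, hμl, -⟩ := muStar_one_pos_and_le (n := n) (σ := σ) (K := K) (S := S) hT hl hlL
  have hq : 0 ≤ n * σ ^ 2 * K ^ 2 := by positivity
  have h : (2 * n * σ ^ 2 * K ^ 2) ^ (1 / 3 : ℝ) * (l / S) ^ (1 / 3 : ℝ)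
      * (1 / (T : ℝ) ^ (2 / 3 : ℝ)) - l / (T : ℝ) ^ 2 ≤ muStar 1 T n σ K l L S := le_max_left _ _
  set μ := muStar 1 T n σ K l L S
  have h1 : l / (T : ℝ) ^ 2 ≤ μ := by
    rw [pow_two, ← div_div, div_le_iff₀ hT']
    exact hμl
  -- The subtracted `l / T²` is itself at most `μ`, so the cube-root expression is at most `2 μ`;
  -- squaring this yields the factor 4.
  have h2 : (n * σ ^ 2 * K ^ 2) ^ (1 / 3 : ℝ) * (l / S) ^ (1 / 3 : ℝ)
      * (1 / (T : ℝ) ^ (2 / 3 : ℝ)) ≤ 2 * μ := by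
    refine le_trans ?_ (by linarith : (2 * n * σ ^ 2 * K ^ 2) ^ (1 / 3 : ℝ) * (l / S) ^ (1 / 3 : ℝ)
      * (1 / (T : ℝ) ^ (2 / 3 : ℝ)) ≤ 2 * μ)
    gcongr
    linarith
  have cube : ∀ r : ℝ, 0 ≤ r → r = (r ^ (1 / 3 : ℝ)) ^ 3 := fun r hr => by
    rw [← Real.rpow_natCast, ← Real.rpow_mul hr]
    norm_num
  have square : ∀ r : ℝ, 0 ≤ r → r ^ (2 / 3 : ℝ) = (r ^ (1 / 3 : ℝ)) ^ 2 := fun r hr => by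
    rw [← Real.rpow_natCast, ← Real.rpow_mul hr]
    norm_num
  rw [Real.div_rpow hl.le hS.le, square _ hT'.le] at h2
  rw [square S hS.le, square l hl.le]
  nth_rw 1 [cube _ hq]
  nth_rw 1 [cube _ hT'.le]
  have ha : 0 ≤ (n * σ ^ 2 * K ^ 2) ^ (1 / 3 : ℝ) := by positivity
  have hs : 0 < S ^ (1 / 3 : ℝ) := by positivity
  have ht : 0 < (T : ℝ) ^ (1 / 3 : ℝ) := by positivity
  have hl' : 0 < l ^ (1 / 3 : ℝ) := by positivity
  generalize (n * σ ^ 2 * K ^ 2) ^ (1 / 3 : ℝ) = a at *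
  generalize S ^ (1 / 3 : ℝ) = s at *
  generalize (T : ℝ) ^ (1 / 3 : ℝ) = t at *
  generalize l ^ (1 / 3 : ℝ) = r at *
  have h3 : a * r ≤ 2 * μ * (s * t ^ 2) := by
    have e : a * (r / s) * (1 / t ^ 2) = a * r / (s * t ^ 2) := by field_simp
    rwa [e, div_le_iff₀ (by positivity)] at h2
  have h4 : (a * r) ^ 2 ≤ (2 * μ * (s * t ^ 2)) ^ 2 := pow_le_pow_left₀ (by positivity) h3 2
  rw [← mul_div_assoc, div_le_div_iff₀ (by positivity) (by positivity)]
  have h5 := mul_le_mul_of_nonneg_left h4 ha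
  linarith

end GraphSignal

/-! ### The error bound for the complete graph -/

open GraphSignal
theorem mainTheorem6 :
    ∃ c₁ c₂ : ℝ, 0 < c₁ ∧ 0 < c₂ ∧
      ∀ (T n : ℕ), 1 ≤ T → 1 ≤ n →
      ∀ (m : Fin T → ℕ) (C : (t : Fin T) → Matrix (Fin (m t)) (Fin n) ℝ)
        (l L : ℝ), 0 < l → 0 < L →
        l ≤ lambdaMin (gram_isHermitian (stackMatrix C)) →
        lambdaMax (gram_isHermitian (stackMatrix C)) ≤ L →
      ∀ (S : ℝ), 0 < S →
      ∀ (x : EuclideanSpace ℝ (Fin T × Fin n)),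
        ‖Matrix.toEuclideanLin (penaltyMatrix n (⊤ : SimpleGraph (Fin T))) x‖ ^ 2 ≤ S →
      ∀ (Ω : Type*) [MeasurableSpace Ω] (P : Measure Ω) [IsProbabilityMeasure P]
        (η : Ω → EuclideanSpace ℝ ((t : Fin T) × Fin (m t))) (σ : ℝ≥0),
        Measurable η → IsSubgaussianVec η σ P →
      ∀ (xhat : Ω → EuclideanSpace ℝ (Fin T × Fin n)),
        (∀ ω, IsMinOn
          (penLSObjective (⊤ : SimpleGraph (Fin T)) C
            (muStar c₁ T n σ (specNorm (blockMatrix C)) l L S)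
            (Matrix.toEuclideanLin (blockMatrix C) x + η ω))
          Set.univ (xhat ω)) →
      ∀ (δ : ℝ), 0 < δ → δ < Real.exp (-1) →
        1 - δ ≤ P.real {ω | ‖xhat ω - x‖ ^ 2 ≤
          c₂ * (S / T + specNorm (blockMatrix C) ^ 2 * (L / l ^ 2) * S
            + ((n * (σ : ℝ) ^ 2 * specNorm (blockMatrix C) ^ 2) ^ (1 / 3 : ℝ)
                  * (T : ℝ) ^ (1 / 3 : ℝ) * S ^ (2 / 3 : ℝ) / l ^ (2 / 3 : ℝ)
                + n * (σ : ℝ) ^ 2 * specNorm (blockMatrix C) ^ 2 * (T : ℝ) ^ 2 / l ^ 2)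
              * Real.log (1 / δ))} := by
  -- 324 = 2 · 6 · 27: the 2 from splitting noise and bias, the 6 from concentration, the 27 from `3
  -- / (l / (3T))²`. The other terms need only 2 · 6 · 8 = 96 and 2.
  refine ⟨1, 324, one_pos, by norm_num, ?_⟩
  intro T n hT hn m C l L hl _ hlmin hLmax S hS x hx Ω _ P _ η σ hη hsub xhat hmin δ hδ hδ'
  have : Nonempty (Fin n) := ⟨⟨0, hn⟩⟩
  have hT' : (0 : ℝ) < T := by exact_mod_cast hT
  have hlL : l ≤ L := (hlmin.trans (lambdaMin_le_lambdaMax _)).trans hLmax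
  have hlog : 0 ≤ Real.log (1 / δ) := by
    refine Real.log_nonneg ((one_le_div hδ).2 (hδ'.le.trans ?_))
    rw [← Real.exp_zero]
    exact Real.exp_le_exp.2 (by norm_num)
  set K := specNorm (blockMatrix C)
  obtain ⟨hμ, hμl, hμK⟩ := muStar_one_pos_and_le (n := n) (σ := σ) (K := K) (S := S) hT hl hlL
  have hμq := div_muStar_sq_le (n := n) (σ := σ) (K := K) hT hl hlL hS
  set μ := muStar 1 T n σ K l L S
  set Cl := Matrix.toEuclideanLin (blockMatrix C)
  set M := Matrix.toEuclideanLin (penaltyMatrix n (⊤ : SimpleGraph (Fin T)))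
  have hQs : (meanProj T n).IsSymmetric := meanProj_isSymmetric
  have hQi := meanProj_meanProj (n := n) hT
  have hM : ∀ v, ‖M v‖ ^ 2 = T * ‖v - meanProj T n v‖ ^ 2 := norm_sq_penaltyMatrix_top hT
  have hK : ∀ v, ‖Cl v‖ ≤ K * ‖v‖ := norm_toEuclideanLin_le_specNorm _
  have hC : ∀ v, l / T * ‖meanProj T n v‖ ^ 2 ≤ ‖Cl (meanProj T n v)‖ ^ 2 := fun v => by
    rw [meanProj, LinearMap.comp_apply, norm_constSignal_sq,
      toEuclideanLin_blockMatrix_constSignal, ← mul_assoc, div_mul_cancel₀ _ hT'.ne']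
    exact (mul_le_mul_of_nonneg_right hlmin (sq_nonneg _)).trans (lambdaMin_mul_norm_sq_le _ _)
  have hcoer := coercive_regOp hQs hQi hM hC hK hl hT' hμl hμK
  have hα : 0 < l / (3 * T) := by positivity
  obtain ⟨R, hR, hR'⟩ := exists_rightInverse_regOp hα hcoer
  set b := EuclideanSpace.basisFun (Fin T × Fin n) ℝ
  have hfrob := sum_norm_sq_inverse_le hQs hQi hM hα hcoer hT' hμ hR b
  rw [sum_norm_sq_meanProj_basisFun hT] at hfrob
  have hRs : R.IsSymmetric := fun u v => by
    have := regOp_isSymmetric Cl M μ (R u) (R v)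
    rw [hR, hR] at this
    exact this.symm
  set bias := R (-(μ • LinearMap.adjoint M (M x)))
  have hbias : ‖bias‖ ^ 2 ≤ S / T + K ^ 2 * S / l :=
    bias_le hQs hQi hM hC hK hl hT' hμ hx (hR _)
  have herr : ∀ ω, xhat ω - x = R (LinearMap.adjoint Cl (η ω)) + bias := fun ω => by
    rw [← map_add, ← hR' (xhat ω - x), map_sub, regOp_eq_of_isMinOn (hmin ω)]
    congr 1
    simp only [map_add, regOp, LinearMap.add_apply, LinearMap.smul_apply, LinearMap.comp_apply]
    abel
  -- Expanding in an orthonormal basis and moving `R` and `C†` across shows the noise as squares of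
  -- linear functionals of `η`.
  have hnoise : ∀ ω, ‖R (LinearMap.adjoint Cl (η ω))‖ ^ 2 = ∑ k, ⟪Cl (R (b k)), η ω⟫ ^ 2 :=
    fun ω => by
      rw [← b.sum_sq_norm_inner_right]
      refine Finset.sum_congr rfl fun k _ => ?_
      rw [Real.norm_eq_abs, sq_abs, ← hRs, LinearMap.adjoint_inner_right]
  have hprob := measureReal_sum_sq_le (P := P) (X := fun k ω => ⟪Cl (R (b k)), η ω⟫)
    (fun k => hη.const_inner) (fun k => hsub.hasSubgaussianMGF_inner _) hδ hδ'
  refine hprob.trans (measureReal_mono fun ω hω => ?_)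
  simp only [Set.mem_ofPred_eq] at hω ⊢
  rw [← hnoise] at hω
  set N := R (LinearMap.adjoint Cl (η ω))
  set B := (n * (σ : ℝ) ^ 2 * K ^ 2) ^ (1 / 3 : ℝ) * (T : ℝ) ^ (1 / 3 : ℝ) * S ^ (2 / 3 : ℝ)
    / l ^ (2 / 3 : ℝ)
  have hB : 0 ≤ B := by positivity
  set D := n * (σ : ℝ) ^ 2 * K ^ 2 * (T : ℝ) ^ 2 / l ^ 2
  have hD : 0 ≤ D := by positivity
  have hV : ∑ k, ((‖Cl (R (b k))‖₊ ^ 2 * σ ^ 2 : ℝ≥0) : ℝ) ≤ 27 * D + 8 * B := by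
    calc ∑ k, ((‖Cl (R (b k))‖₊ ^ 2 * σ ^ 2 : ℝ≥0) : ℝ)
        ≤ ∑ k, (σ : ℝ) ^ 2 * K ^ 2 * ‖R (b k)‖ ^ 2 := by
          refine Finset.sum_le_sum fun k _ => ?_
          push_cast
          have := pow_le_pow_left₀ (norm_nonneg _) (hK (R (b k))) 2
          calc _ ≤ (K * ‖R (b k)‖) ^ 2 * (σ : ℝ) ^ 2 := by gcongr
            _ = _ := by ring
      _ ≤ (σ : ℝ) ^ 2 * K ^ 2 * (3 * n / (l / (3 * T)) ^ 2
            + 2 * Fintype.card (Fin T × Fin n) / (μ * T) ^ 2) := by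
          rw [← Finset.mul_sum]
          gcongr
      _ = 27 * D + 2 * (n * (σ : ℝ) ^ 2 * K ^ 2 / (T * μ ^ 2)) := by
          simp only [Fintype.card_prod, Fintype.card_fin, D]
          push_cast
          field_simp
          ring
      _ ≤ 27 * D + 8 * B := by linarith
  have hN : ‖N‖ ^ 2 ≤ 6 * (27 * D + 8 * B) * Real.log (1 / δ) := hω.trans (by gcongr)
  have hKL : K ^ 2 * S / l ≤ K ^ 2 * (L / l ^ 2) * S := by
    have : 1 / l ≤ L / l ^ 2 := by
      rw [div_le_div_iff₀ hl (by positivity)]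
      nlinarith
    calc K ^ 2 * S / l = K ^ 2 * (1 / l) * S := by ring
      _ ≤ _ := by gcongr
  have hsum : ‖xhat ω - x‖ ^ 2 ≤ 2 * ‖N‖ ^ 2 + 2 * ‖bias‖ ^ 2 := by
    rw [herr ω]
    have := parallelogram_law_with_norm ℝ N bias
    nlinarith [sq_nonneg ‖N - bias‖]
  have hST : 0 ≤ S / T := by positivity
  have hKS : 0 ≤ K ^ 2 * S / l := by positivity
  have hBl := mul_nonneg hB hlog
  nlinarith
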